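/- All graphs are finite, simple and undirected. For a connected graph $G$ with vertices $v_1,\dots,v_n$, let $D(G)=(d_G(v_i,v_j))_{i,j}$ be its distance matrix, where $d_G(u,v)$ is the length of a shortest path between $u$ and $v$, and let the distance spectral radius $\rho(G)$ be the largest eigenvalue of $D(G)$. For $n\ge 3$, let the kite graph $K_3^{(n)}$ be the graph of order $n$ obtained from a triangle by attaching a path of length $n-3$ (by one of its end vertices) at a vertex of the triangle. Let $\mathcal{G}_{3,n}$ be the family of connected graphs of order $n$ with chromatic number exactly $3$. Then for every $n\ge 3$, $K_3^{(n)}$ is, up to isomorphism, the unique graph maximizing the distance spectral radius in $\mathcal{G}_{3,n}$: $K_3^{(n)}\in\mathcal{G}_{3,n}$, and every $G\in\mathcal{G}_{3,n}$ satisfies $\rho(G)\le\rho(K_3^{(n)})$, with equality if and only if $G\cong K_3^{(n)}$. -/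

import Mathlib

/-- The distance matrix of a finite graph, with entries `d_G(u, v)`
(meaningful for connected graphs). -/
noncomputable def distMatrix {V : Type*} (G : SimpleGraph V) : Matrix V V ℝ :=
  Matrix.of fun u v => (G.dist u v : ℝ)

/-- The distance spectral radius: the largest (real) eigenvalue of the distance matrix. -/
noncomputable def distSpectralRadius {V : Type*} [Fintype V] (G : SimpleGraph V) : ℝ :=
  sSup {μ : ℝ | Module.End.HasEigenvalue (distMatrix G).mulVecLin μ}

/-- On a non-empty vertex set the supremum is attained, so `distSpectralRadius G` is indeed the
largest eigenvalue of the distance matrix. -/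
theorem isGreatest_distSpectralRadius {V : Type*} [Fintype V] [Nonempty V] (G : SimpleGraph V) :
    IsGreatest {μ : ℝ | Module.End.HasEigenvalue (distMatrix G).mulVecLin μ}
      (distSpectralRadius G) := by
  classical
  have hD : (distMatrix G).IsHermitian := by
    ext u v
    simp [distMatrix, SimpleGraph.dist_comm]
  have hfin : {μ : ℝ | Module.End.HasEigenvalue (distMatrix G).mulVecLin μ}.Finite :=
    Module.End.finite_hasEigenvalue _
  have hne : {μ : ℝ | Module.End.HasEigenvalue (distMatrix G).mulVecLin μ}.Nonempty := by
    obtain ⟨i⟩ := ‹Nonempty V›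
    refine ⟨hD.eigenvalues i, Module.End.hasEigenvalue_of_hasEigenvector
      (x := (hD.eigenvectorBasis i).ofLp) ⟨?_, ?_⟩⟩
    · rw [Module.End.mem_eigenspace_iff]
      simpa using hD.mulVec_eigenvectorBasis i
    · intro h
      apply hD.eigenvectorBasis.orthonormal.ne_zero i
      ext j
      simpa using congrFun h j
  exact ⟨hne.csSup_mem hfin, fun _ hx => le_csSup hfin.bddAbove hx⟩

/-- The kite graph of order `n` (for `1 ≤ k ≤ n`): the vertices `0, …, k - 1` form a `k`-clique, and
the path `k - 1, k, …, n - 1` of length `n - k` is attached at its vertex `k - 1`. -/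
def kiteGraph (k n : ℕ) : SimpleGraph (Fin n) where
  Adj i j := i ≠ j ∧ ((i.val < k ∧ j.val < k) ∨ i.val + 1 = j.val ∨ j.val + 1 = i.val)
  symm := ⟨fun i j h => ⟨h.1.symm, by have := h.2; tauto⟩⟩
  loopless := ⟨fun i h => h.1 rfl⟩

/-- `G` belongs to the family of connected `k`-chromatic graphs of order `n`. -/
def IsConnectedChromatic {V : Type*} [Fintype V] (k n : ℕ) (G : SimpleGraph V) : Prop :=
  G.Connected ∧ G.chromaticNumber = k ∧ Fintype.card V = n

/-! For a positive weight x let q_x(G) be the sum of x_u x_v d_G(u, v). If x is the Perron vector of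
G, then ρ(G)∑x² = q_x(G), while q_x of any relabelled kite is at most ρ(kite)∑x². So it suffices
that, for every positive x, each connected non-bipartite G other than the kite has smaller q_x than
some relabelled kite (`nonempty_iso_or_exists_weightedDist_lt`). Allowing all x makes induction on
the order possible.

Either some vertex l has G - l connected and non-bipartite, or G has a spanning odd cycle. In the
first case keep a single edge lp at l: no distance drops, and q_x becomes the form of G - l with the
weight of l moved to p, plus a term depending only on x and l (`weightedDist_pendantExtension`).
Induction replaces G - l by a kite, and `exists_pendantDist_lt` improves the result unless l hangs
at the end of the tail. In the second case the cycle is a triangle or is beaten by a kite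
(`weightedDist_cycle_lt`).

Both explicit comparisons bound the change of distances below by a form α ⊗ β + β ⊗ α with ⟨x, α⟩
and ⟨x, β⟩ positive (`weightedDist_lt_of_add_le`). -/

/-- The quadratic form `∑ x u x v d(u, v)` of an integer-valued distance function `d`. -/
noncomputable def weightedDist {V : Type*} [Fintype V] (x : V → ℝ) (d : V → V → ℕ) : ℝ :=
  ∑ u, ∑ v, x u * x v * d u v

/-! ### Comparison of weighted distances -/

section weightedDist

variable {V W : Type*} [Fintype V] [Fintype W] {x : V → ℝ} {d d' : V → V → ℕ}

theorem weightedDist_mono (hx : ∀ u, 0 ≤ x u) (h : ∀ u v, d u v ≤ d' u v) :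
    weightedDist x d ≤ weightedDist x d' :=
  Finset.sum_le_sum fun u _ => Finset.sum_le_sum fun v _ =>
    mul_le_mul_of_nonneg_left (by exact_mod_cast h u v) (mul_nonneg (hx u) (hx v))

theorem weightedDist_lt (hx : ∀ u, 0 < x u) (h : ∀ u v, d u v ≤ d' u v) {a b : V}
    (hab : d a b < d' a b) : weightedDist x d < weightedDist x d' := by
  have hle : ∀ u v, x u * x v * (d u v : ℝ) ≤ x u * x v * (d' u v : ℝ) := fun u v =>
    mul_le_mul_of_nonneg_left (by exact_mod_cast h u v) (mul_pos (hx u) (hx v)).le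
  refine Finset.sum_lt_sum (fun u _ => Finset.sum_le_sum fun v _ => hle u v)
    ⟨a, Finset.mem_univ _, Finset.sum_lt_sum (fun v _ => hle a v) ⟨b, Finset.mem_univ _, ?_⟩⟩
  exact mul_lt_mul_of_pos_left (by exact_mod_cast hab) (mul_pos (hx a) (hx b))

/-- If `d' - d` is at least the symmetric rank-two form `α ⊗ β + β ⊗ α`, and `x` pairs positively
with `α` and `β`, then the weighted distance increases. -/
theorem weightedDist_lt_of_add_le (hx : ∀ u, 0 < x u) (α β : V → ℝ)
    (h : ∀ u v, (d u v : ℝ) + (α u * β v + β u * α v) ≤ d' u v)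
    (hα : 0 < ∑ u, x u * α u) (hβ : 0 < ∑ u, x u * β u) :
    weightedDist x d < weightedDist x d' := by
  have key : ∑ u, ∑ v, x u * x v * ((d u v : ℝ) + (α u * β v + β u * α v)) ≤
      weightedDist x d' :=
    Finset.sum_le_sum fun u _ => Finset.sum_le_sum fun v _ =>
      mul_le_mul_of_nonneg_left (h u v) (mul_pos (hx u) (hx v)).le
  have expand : ∑ u, ∑ v, x u * x v * ((d u v : ℝ) + (α u * β v + β u * α v)) =
      weightedDist x d + 2 * ((∑ u, x u * α u) * ∑ u, x u * β u) := by
    have h1 : (∑ u, x u * α u) * ∑ u, x u * β u = ∑ u, ∑ v, (x u * α u) * (x v * β v) :=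
      Finset.sum_mul_sum _ _ _ _
    have h2 : (∑ u, x u * α u) * ∑ u, x u * β u = ∑ u, ∑ v, (x u * β u) * (x v * α v) := by
      rw [mul_comm]; exact Finset.sum_mul_sum _ _ _ _
    rw [two_mul]
    nth_rw 1 [h1]
    rw [h2, weightedDist]
    simp only [← Finset.sum_add_distrib]
    exact Finset.sum_congr rfl fun u _ => Finset.sum_congr rfl fun v _ => by ring
  have := mul_pos hα hβ
  linarith

theorem weightedDist_equiv (e : V ≃ W) (x : W → ℝ) (d : W → W → ℕ) :
    weightedDist (fun v => x (e v)) (fun u v => d (e u) (e v)) = weightedDist x d := by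
  unfold weightedDist
  rw [← e.sum_comp]
  exact Finset.sum_congr rfl fun u _ => e.sum_comp fun v => x (e u) * x v * (d (e u) v : ℝ)

theorem weightedDist_eq_dotProduct (G : SimpleGraph V) (x : V → ℝ) :
    weightedDist x G.dist = x ⬝ᵥ (distMatrix G).mulVec x := by
  simp only [weightedDist, dotProduct, Matrix.mulVec, distMatrix, Matrix.of_apply, Finset.mul_sum]
  exact Finset.sum_congr rfl fun u _ => Finset.sum_congr rfl fun v _ => by ring

end weightedDist

/-! ### Rayleigh principle and Perron vector -/

section Spectral

variable {V : Type*} [Fintype V]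

/-- The Rayleigh bound in matrix form; semidefiniteness also handles equality, since a vector where
the form vanishes lies in the kernel. -/
theorem posSemidef_distSpectralRadius_sub [DecidableEq V] [Nonempty V] (G : SimpleGraph V) :
    (distSpectralRadius G • (1 : Matrix V V ℝ) - distMatrix G).PosSemidef := by
  have hM : (distSpectralRadius G • (1 : Matrix V V ℝ) - distMatrix G).IsHermitian := by
    ext u v
    simp [distMatrix, SimpleGraph.dist_comm, Matrix.one_apply, eq_comm]
  rw [hM.posSemidef_iff_eigenvalues_nonneg]
  intro i
  have hv : hM.eigenvectorBasis i ≠ 0 := hM.eigenvectorBasis.orthonormal.ne_zero i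
  have hmul := hM.mulVec_eigenvectorBasis i
  rw [Matrix.sub_mulVec, Matrix.smul_mulVec, Matrix.one_mulVec] at hmul
  have hmem : Module.End.HasEigenvalue (distMatrix G).mulVecLin
      (distSpectralRadius G - hM.eigenvalues i) := by
    refine Module.End.hasEigenvalue_of_hasEigenvector
      (x := (hM.eigenvectorBasis i).ofLp) ⟨?_, ?_⟩
    · rw [Module.End.mem_eigenspace_iff, Matrix.mulVecLin_apply, sub_smul, ← hmul]
      abel
    · intro h
      apply hv
      ext j
      simpa using congrFun h j
  have := (isGreatest_distSpectralRadius G).2 hmem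
  simp only [Pi.zero_apply]
  linarith

theorem weightedDist_le_distSpectralRadius [Nonempty V] (G : SimpleGraph V) (x : V → ℝ) :
    weightedDist x G.dist ≤ distSpectralRadius G * ∑ u, x u * x u := by
  classical
  have h := (posSemidef_distSpectralRadius_sub G).dotProduct_mulVec_nonneg x
  rw [Matrix.sub_mulVec, Matrix.smul_mulVec, Matrix.one_mulVec, dotProduct_sub, dotProduct_smul,
    star_trivial, ← weightedDist_eq_dotProduct, smul_eq_mul] at h
  exact sub_nonneg.mp h

/-- The distance matrix of a connected graph has a positive eigenvector for its largest
eigenvalue. -/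
theorem exists_pos_eigenvector [Nontrivial V] {G : SimpleGraph V} (hG : G.Connected) :
    ∃ x : V → ℝ, (∀ u, 0 < x u) ∧
      weightedDist x G.dist = distSpectralRadius G * ∑ u, x u * x u := by
  classical
  obtain ⟨y, hy, hy0⟩ := (isGreatest_distSpectralRadius G).1.exists_hasEigenvector
  rw [Module.End.mem_eigenspace_iff, Matrix.mulVecLin_apply] at hy
  have hyq : weightedDist y G.dist = distSpectralRadius G * ∑ u, y u * y u := by
    rw [weightedDist_eq_dotProduct, hy, dotProduct_smul, smul_eq_mul]
    rfl
  -- Taking absolute values keeps the norm and does not lower the form, so |y| attains the Rayleigh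
  -- bound and is itself an eigenvector.
  set x : V → ℝ := fun u => |y u| with hx
  have hxx : ∑ u, x u * x u = ∑ u, y u * y u :=
    Finset.sum_congr rfl fun u _ => abs_mul_abs_self _
  have hle : weightedDist y G.dist ≤ weightedDist x G.dist :=
    Finset.sum_le_sum fun u _ => Finset.sum_le_sum fun v _ =>
      mul_le_mul_of_nonneg_right ((le_abs_self _).trans (abs_mul _ _).le) (Nat.cast_nonneg _)
  have hxq : weightedDist x G.dist = distSpectralRadius G * ∑ u, x u * x u :=
    le_antisymm (weightedDist_le_distSpectralRadius G x) (by rw [hxx, ← hyq]; exact hle)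
  have hker : (distSpectralRadius G • (1 : Matrix V V ℝ) - distMatrix G).mulVec x = 0 := by
    rw [← (posSemidef_distSpectralRadius_sub G).dotProduct_mulVec_zero_iff, Matrix.sub_mulVec,
      Matrix.smul_mulVec, Matrix.one_mulVec, dotProduct_sub, dotProduct_smul, star_trivial,
      ← weightedDist_eq_dotProduct, smul_eq_mul, hxq]
    exact sub_self _
  rw [Matrix.sub_mulVec, Matrix.smul_mulVec, Matrix.one_mulVec, sub_eq_zero] at hker
  -- A zero entry at u makes row u of the eigenvalue equation a vanishing sum of nonnegative terms;
  -- as off-diagonal distances are positive, y would be zero.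
  refine ⟨x, fun u => (abs_nonneg _).lt_of_ne' fun hu => hy0 (funext fun v => ?_), hxq⟩
  have hsum : ∑ v, (G.dist u v : ℝ) * x v = 0 := by
    have := congrFun hker u
    rw [Pi.smul_apply, show x u = 0 from hu, smul_zero] at this
    exact this.symm
  by_cases huv : u = v
  · exact abs_eq_zero.mp (huv ▸ hu)
  · have := (Finset.sum_eq_zero_iff_of_nonneg fun w _ =>
      mul_nonneg (Nat.cast_nonneg _) (abs_nonneg _)).mp hsum v (Finset.mem_univ _)
    rcases mul_eq_zero.mp this with h | h
    · exact absurd (Nat.cast_eq_zero.mp h) (hG.pos_dist_of_ne huv).ne'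
    · exact abs_eq_zero.mp h

end Spectral

/-! ### Isomorphism invariance -/

theorem SimpleGraph.Iso.dist_le {V W : Type*} {G : SimpleGraph V} {H : SimpleGraph W}
    (e : G ≃g H) (hG : G.Connected) (u v : V) : H.dist (e u) (e v) ≤ G.dist u v := by
  obtain ⟨p, hp⟩ := hG.exists_walk_length_eq_dist u v
  rw [← hp, ← SimpleGraph.Walk.length_map e.toHom p]
  exact SimpleGraph.dist_le _

theorem SimpleGraph.Iso.dist_eq {V W : Type*} {G : SimpleGraph V} {H : SimpleGraph W}
    (e : G ≃g H) (hG : G.Connected) (u v : V) : H.dist (e u) (e v) = G.dist u v := by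
  refine le_antisymm (e.dist_le hG u v) ?_
  simpa using e.symm.dist_le (e.connected_iff.mp hG) (e u) (e v)

theorem SimpleGraph.Iso.distSpectralRadius_le {V W : Type*} [Fintype V] [Fintype W]
    [Nontrivial V] {G : SimpleGraph V} {H : SimpleGraph W} (e : G ≃g H) (hG : G.Connected) :
    distSpectralRadius G ≤ distSpectralRadius H := by
  obtain ⟨x, hx, hxq⟩ := exists_pos_eigenvector hG
  have : Nonempty W := ⟨e hG.nonempty.some⟩
  have h := weightedDist_le_distSpectralRadius H (fun w => x (e.symm w))
  have h1 : weightedDist (fun w => x (e.symm w)) H.dist = weightedDist x G.dist := by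
    rw [← weightedDist_equiv e.toEquiv.symm]
    congr 1
    funext u v
    have h := e.dist_eq hG (e.symm u) (e.symm v)
    rwa [e.apply_symm_apply, e.apply_symm_apply] at h
  have h2 : ∑ w, x (e.symm w) * x (e.symm w) = ∑ u, x u * x u :=
    e.toEquiv.symm.sum_comp fun u => x u * x u
  rw [h1, h2, hxq] at h
  refine le_of_mul_le_mul_right h (Finset.sum_pos (fun u _ => mul_pos (hx u) (hx u)) ?_)
  exact Finset.univ_nonempty

theorem SimpleGraph.Iso.distSpectralRadius_eq {V W : Type*} [Fintype V] [Fintype W]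
    [Nontrivial V] {G : SimpleGraph V} {H : SimpleGraph W} (e : G ≃g H) (hG : G.Connected) :
    distSpectralRadius G = distSpectralRadius H := by
  have : Nontrivial W := e.symm.toEquiv.nontrivial
  exact le_antisymm (e.distSpectralRadius_le hG)
    (e.symm.distSpectralRadius_le (e.connected_iff.mp hG))

/-! ### Distances, colouring and symmetries of the kite -/

/-- The distance between the vertices `i` and `j` of a kite graph with a triangle. -/
def kiteDist (i j : ℕ) : ℕ :=
  if i = j then 0 else if i ≤ 1 ∧ j ≤ 1 then 1 else (max i 1 - max j 1) + (max j 1 - max i 1)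

theorem kiteDist_comm (i j : ℕ) : kiteDist i j = kiteDist j i := by
  unfold kiteDist
  grind

section kiteGraph

variable {n : ℕ}

theorem kiteGraph_adj_iff_kiteDist {i j : Fin n} :
    (kiteGraph 3 n).Adj i j ↔ kiteDist i j = 1 := by
  simp only [kiteGraph, kiteDist, ne_eq, Fin.ext_iff]
  grind

/-- Crossing one edge changes `kiteDist` to a fixed vertex by at most one. The `max · 1` in it gives
the twin vertices 0 and 1 the same position on the tail. -/
theorem kiteDist_le_length {i j : Fin n} (p : (kiteGraph 3 n).Walk i j) :
    kiteDist i j ≤ p.length := by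
  induction p with
  | nil => simp [kiteDist]
  | @cons u v w h p ih =>
    rw [SimpleGraph.Walk.length_cons]
    refine le_trans ?_ (Nat.add_le_add_right ih 1)
    rw [kiteGraph_adj_iff_kiteDist] at h
    revert h
    unfold kiteDist
    split_ifs <;> intro h <;> omega

theorem exists_walk_kiteGraph (i j : Fin n) :
    ∃ p : (kiteGraph 3 n).Walk i j, p.length = kiteDist i j := by
  wlog hij : i ≤ j generalizing i j
  · obtain ⟨p, hp⟩ := this j i (le_of_not_ge hij)
    exact ⟨p.reverse, by rw [SimpleGraph.Walk.length_reverse, hp, kiteDist_comm]⟩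
  obtain ⟨k, hk⟩ : ∃ k, kiteDist i j = k := ⟨_, rfl⟩
  induction k generalizing j with
  | zero =>
    have : i = j := by
      revert hk
      simp only [kiteDist, Fin.ext_iff]
      have : (i : ℕ) ≤ j := hij
      grind
    subst this
    exact ⟨.nil, hk.symm⟩
  | succ k ih =>
    by_cases h : kiteDist i j = 1
    · exact ⟨.cons (kiteGraph_adj_iff_kiteDist.mpr h) .nil, by simp [h]⟩
    · have hij' : (i : ℕ) ≤ j := hij
      have hlt : (i : ℕ) < j - 1 ∧ 3 ≤ (j : ℕ) ∧ kiteDist i (j - 1) = k := by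
        revert hk h
        unfold kiteDist
        grind
      obtain ⟨p, hp⟩ := ih ⟨j - 1, by omega⟩ (Fin.le_def.mpr hlt.1.le) hlt.2.2
      have hadj : (kiteGraph 3 n).Adj ⟨(j : ℕ) - 1, by omega⟩ j := by
        rw [kiteGraph_adj_iff_kiteDist]
        simp only [kiteDist]
        split_ifs <;> omega
      exact ⟨p.concat hadj, by
        rw [SimpleGraph.Walk.length_concat, hp, hk]
        exact congrArg (· + 1) hlt.2.2⟩

theorem kiteGraph_dist (i j : Fin n) : (kiteGraph 3 n).dist i j = kiteDist i j := by
  obtain ⟨p, hp⟩ := exists_walk_kiteGraph i j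
  refine le_antisymm (hp ▸ SimpleGraph.dist_le p) ?_
  obtain ⟨q, hq⟩ := SimpleGraph.Reachable.exists_walk_length_eq_dist ⟨p⟩
  exact hq ▸ kiteDist_le_length q

theorem kiteGraph_connected (hn : 0 < n) : (kiteGraph 3 n).Connected where
  preconnected i j := ⟨(exists_walk_kiteGraph i j).choose⟩
  nonempty := ⟨⟨0, hn⟩⟩

theorem kiteGraph_chromaticNumber (hn : 3 ≤ n) : (kiteGraph 3 n).chromaticNumber = 3 := by
  refine SimpleGraph.chromaticNumber_eq_iff_colorable_not_colorable (n := 2).mpr ⟨?_, fun h => ?_⟩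
  -- Colours 0, 1, 2 on the triangle, then 1 and 2 alternating along the tail.
  · refine ⟨SimpleGraph.Coloring.mk
      (fun i : Fin n => if (i : ℕ) < 2 then (Fin.ofNat 3 i) else
        if (i : ℕ) % 2 = 0 then 2 else 1) ?_⟩
    intro i j hij
    simp only [kiteGraph, ne_eq, Fin.ext_iff] at hij ⊢
    split_ifs <;> simp <;> omega
  · have := h.card_le_of_pairwise_adj (Fin.castLE hn) ?_
    · simp at this
    · intro i j hij
      refine ⟨fun h => hij (Fin.castLE_injective hn h), Or.inl ⟨?_, ?_⟩⟩ <;> simp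

theorem kiteDist_swap (i j : Fin (n + 2)) :
    kiteDist (Equiv.swap 0 1 i : Fin (n + 2)) (Equiv.swap 0 1 j : Fin (n + 2)) = kiteDist i j := by
  have h : ∀ i : Fin (n + 2), ((Equiv.swap 0 1 i : Fin (n + 2)) : ℕ) =
      if (i : ℕ) = 0 then 1 else if (i : ℕ) = 1 then 0 else (i : ℕ) := by
    intro i
    rw [Equiv.swap_apply_def]
    simp only [Fin.ext_iff, Fin.val_zero, Fin.val_one]
    split_ifs <;> simp
  rw [h, h]
  unfold kiteDist
  split_ifs <;> omega

theorem kiteDist_eq_ite_of_lt_three {i j : ℕ} (hi : i < 3) (hj : j < 3) :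
    kiteDist i j = if i = j then 0 else 1 := by
  unfold kiteDist
  split_ifs <;> omega

/-- The automorphisms of a kite allow moving a vertex away from `0`, and to `2` in the triangle. -/
theorem exists_perm_kiteDist (hn : 3 ≤ n) (a : Fin n) :
    ∃ τ : Equiv.Perm (Fin n), (∀ i j, kiteDist (τ i) (τ j) = kiteDist i j) ∧
      (τ a : ℕ) ≠ 0 ∧ (n = 3 → (τ a : ℕ) = 2) := by
  obtain ⟨m, rfl⟩ : ∃ m, n = m + 2 := ⟨n - 2, by omega⟩
  by_cases hm : m = 1
  · subst hm
    refine ⟨Equiv.swap a 2, fun i j => ?_, by simp, fun _ => by simp⟩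
    rw [kiteDist_eq_ite_of_lt_three (Fin.isLt _) (Fin.isLt _),
      kiteDist_eq_ite_of_lt_three (Fin.isLt _) (Fin.isLt _)]
    simp [← Fin.ext_iff]
  · by_cases ha : a = 0
    · exact ⟨Equiv.swap 0 1, kiteDist_swap, by simp [ha], by omega⟩
    · exact ⟨1, fun _ _ => rfl, fun h => ha (Fin.ext h), by omega⟩

end kiteGraph

/-! ### Odd cycles and deletable vertices -/

namespace SimpleGraph

variable {V : Type*} {G : SimpleGraph V}

/-- `c 0, c 1, …, c N = c 0` is a closed walk of odd length `N`. -/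
def IsOddLoop (G : SimpleGraph V) (c : ℕ → V) (N : ℕ) : Prop :=
  Odd N ∧ (∀ i < N, G.Adj (c i) (c (i + 1))) ∧ c N = c 0

theorem exists_isOddLoop (h : ¬G.Colorable 2) : ∃ N c, G.IsOddLoop c N := by
  rw [two_colorable_iff_forall_loop_even] at h
  push Not at h
  obtain ⟨u, p, hp⟩ := h
  exact ⟨p.length, p.getVert, Nat.not_even_iff_odd.mp hp, fun i hi => p.adj_getVert_succ hi,
    by simp⟩

theorem IsOddLoop.not_colorable {c : ℕ → V} {N : ℕ} (h : G.IsOddLoop c N) : ¬G.Colorable 2 := by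
  rintro ⟨f⟩
  obtain ⟨hN, hadj, hc⟩ := h
  have key : ∀ i ≤ N, ((f (c i) : ℕ) + f (c 0) + i) % 2 = 0 := by
    intro i
    induction i with
    | zero => omega
    | succ i ih =>
      intro hi
      have h1 := ih (by omega)
      have h2 : (f (c i) : ℕ) ≠ f (c (i + 1)) := fun h => f.valid (hadj i hi) (Fin.ext h)
      omega
  have := key N le_rfl
  rw [hc] at this
  rw [Nat.odd_iff] at hN
  omega

/-- A shortest odd closed walk is injective; extended periodically it is an odd cycle. -/
theorem exists_odd_cycle (h : ¬G.Colorable 2) : ∃ (N : ℕ) (c : ℕ → V), Odd N ∧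
    (∀ i, G.Adj (c i) (c (i + 1))) ∧ (∀ i, c (i + N) = c i) ∧
    ∀ i j, i < N → j < N → c i = c j → i = j := by
  classical
  let N := Nat.find (exists_isOddLoop h)
  obtain ⟨c, hN, hadj, hc⟩ : ∃ c, G.IsOddLoop c N := Nat.find_spec (exists_isOddLoop h)
  have hmin : ∀ M c', M < N → ¬G.IsOddLoop c' M := fun M c' hM hc' =>
    Nat.find_min (exists_isOddLoop h) hM ⟨c', hc'⟩
  have hinj : ∀ i j, i < j → j < N → c i ≠ c j := by
    intro i j hij hj hcc
    -- At a repeated vertex, an even segment can be cut out, and an odd segment is itself a shorter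
    -- odd loop.
    rcases Nat.even_or_odd (j - i) with he | ho
    · refine hmin (N - (j - i)) (fun k => if k ≤ i then c k else c (k + (j - i))) (by omega)
        ⟨?_, fun k hk => ?_, ?_⟩
      · rw [Nat.odd_iff] at *
        rw [Nat.even_iff] at he
        omega
      · beta_reduce
        rcases lt_trichotomy k i with hki | rfl | hki
        · rw [if_pos hki.le, if_pos (by omega)]
          exact hadj k (by omega)
        · rw [if_pos le_rfl, if_neg (by omega), hcc, show k + 1 + (j - k) = j + 1 by omega]
          exact hadj j hj
        · rw [if_neg (by omega), if_neg (by omega),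
            show k + 1 + (j - i) = k + (j - i) + 1 by omega]
          exact hadj _ (by omega)
      · simp only [Nat.zero_le, if_true]
        rw [if_neg (by omega), ← hc]
        congr 1
        omega
    · refine hmin (j - i) (fun k => c (i + k)) (by omega) ⟨ho, fun k hk => hadj (i + k) (by omega),
        ?_⟩
      simp only [add_zero]
      rw [hcc]
      congr 1
      omega
  have hN0 : 0 < N := hN.pos
  refine ⟨N, fun k => c (k % N), hN, fun i => ?_, fun i => by simp, fun i j hi hj hij => ?_⟩
  · beta_reduce
    have hi := Nat.mod_lt i hN0
    rcases Nat.lt_or_ge (i % N + 1) N with h | h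
    · have : (i + 1) % N = i % N + 1 := by
        rw [Nat.add_mod, Nat.mod_eq_of_lt (show 1 < N by omega), Nat.mod_eq_of_lt h]
      rw [this]
      exact hadj _ hi
    · have h' : i % N + 1 = N := by omega
      have : (i + 1) % N = 0 := by
        rw [← Nat.mod_add_mod, h', Nat.mod_self]
      have h2 := hadj _ hi
      rw [h', hc] at h2
      rwa [this]
  · simp only [Nat.mod_eq_of_lt hi, Nat.mod_eq_of_lt hj] at hij
    rcases lt_trichotomy i j with h | h | h
    · exact absurd hij (hinj i j h hj)
    · exact h
    · exact absurd hij.symm (hinj j i h hi)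

theorem reachable_comap_succAbove {m : ℕ} {G : SimpleGraph (Fin (m + 1))} {l u v : Fin (m + 1)}
    (p : G.Walk u v) (hp : l ∉ p.support) {a b : Fin m} (ha : l.succAbove a = u)
    (hb : l.succAbove b = v) : (G.comap l.succAbove).Reachable a b := by
  induction p generalizing a with
  | nil => rw [Fin.succAbove_right_injective (ha.trans hb.symm)]
  | @cons u w v h p ih =>
    rw [Walk.support_cons, List.mem_cons, not_or] at hp
    have hw : w ≠ l := fun hwl => hp.2 (hwl ▸ p.start_mem_support)
    obtain ⟨w', hw'⟩ := Fin.exists_succAbove_eq hw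
    have hadj : (G.comap l.succAbove).Adj a w' := by
      rw [comap_adj, ha, hw']
      exact h
    exact hadj.reachable.trans (ih hp.2 hw' hb)

/-- A connected non-bipartite graph either has a vertex whose deletion leaves it connected and
non-bipartite, or has an odd Hamiltonian cycle. -/
theorem exists_delete_or_odd_hamiltonian {m : ℕ} {G : SimpleGraph (Fin (m + 1))}
    (hG : G.Connected) (hc : ¬G.Colorable 2) :
    (∃ l : Fin (m + 1), (G.comap l.succAbove).Connected ∧ ¬(G.comap l.succAbove).Colorable 2) ∨
    ∃ c : ℕ → Fin (m + 1), Odd (m + 1) ∧ (∀ i, G.Adj (c i) (c (i + 1))) ∧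
      (∀ i, c (i + (m + 1)) = c i) ∧ ∀ i j, i < m + 1 → j < m + 1 → c i = c j → i = j := by
  classical
  obtain ⟨N, c, hN, hadj, hper, hinj⟩ := exists_odd_cycle hc
  by_cases hsurj : ∀ v, ∃ i, c i = v
  · right
    have hNm : N = m + 1 := by
      have h1 : ((Finset.range N).image c) = Finset.univ := by
        refine Finset.eq_univ_of_forall fun v => ?_
        obtain ⟨i, hi⟩ := hsurj v
        have hper' : Function.Periodic c N := hper
        exact Finset.mem_image.mpr ⟨i % N, Finset.mem_range.mpr (Nat.mod_lt _ hN.pos),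
          (hper'.map_mod_nat i).trans hi⟩
      have h2 := Finset.card_image_of_injOn (s := Finset.range N) (f := c)
        (fun i hi j hj h => hinj i j (by simpa using hi) (by simpa using hj) h)
      rw [h1] at h2
      simpa using h2.symm
    subst hNm
    exact ⟨c, hN, hadj, hper, hinj⟩
  · left
    push Not at hsurj
    -- With l farthest from `c 0` among the vertices off the cycle, no shortest path to `c 0` from
    -- another such vertex passes through l.
    obtain ⟨l, hl, hmax⟩ := Finset.exists_max_image
      (Finset.univ.filter fun v => ∀ i, c i ≠ v) (fun v => G.dist v (c 0))
      (by obtain ⟨v, hv⟩ := hsurj; exact ⟨v, by simpa using hv⟩)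
    simp only [Finset.mem_filter, Finset.mem_univ, true_and] at hl hmax
    choose c' hc' using fun i => Fin.exists_succAbove_eq (hl i)
    have hadj' : ∀ i, (G.comap l.succAbove).Adj (c' i) (c' (i + 1)) := fun i => by
      rw [comap_adj, hc', hc']
      exact hadj i
    refine ⟨l, ?_, ?_⟩
    · have hreach : ∀ a, (G.comap l.succAbove).Reachable a (c' 0) := by
        intro a
        by_cases ha : ∃ i, c i = l.succAbove a
        · obtain ⟨i, hi⟩ := ha
          rw [← hc', Fin.succAbove_right_inj] at hi
          rw [← hi]
          clear hi
          induction i with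
          | zero => rfl
          | succ i ih => exact (hadj' i).reachable.symm.trans ih
        · push Not at ha
          obtain ⟨p, hp⟩ := hG.exists_walk_length_eq_dist (l.succAbove a) (c 0)
          refine reachable_comap_succAbove p (fun hlp => ?_) rfl (hc' 0)
          have h1 := hmax _ ha
          have h2 := dist_le (p.dropUntil l hlp)
          have h3 : p.length = _ := congrArg Walk.length (p.take_spec hlp).symm
          rw [Walk.length_append] at h3
          have h4 : (p.takeUntil l hlp).length ≠ 0 := fun h =>
            Fin.succAbove_ne l a (Walk.eq_of_length_eq_zero h)
          omega
      exact { preconnected := fun a b => (hreach a).trans (hreach b).symm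
              nonempty := ⟨c' 0⟩ }
    · refine IsOddLoop.not_colorable (c := c') (N := N) ⟨hN, fun i _ => hadj' i, ?_⟩
      refine Fin.succAbove_right_injective (p := l) ?_
      rw [hc', hc']
      simpa using hper 0

theorem dist_le_of_adj_succ (hG : G.Connected) {c : ℕ → V} (hadj : ∀ i, G.Adj (c i) (c (i + 1)))
    (i k : ℕ) : G.dist (c i) (c (i + k)) ≤ k := by
  induction k with
  | zero => simp
  | succ k ih =>
    refine (hG.dist_triangle (v := c (i + k))).trans ?_
    have := dist_eq_one_iff_adj.mpr (hadj (i + k))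
    rw [← add_assoc, this]
    omega

end SimpleGraph

/-! ### Explicit comparisons with the kite -/

/-- Reduces the rank-two criterion to integer inequalities for a < b, within reach of `omega`;
disjoint supports of α and β settle the diagonal. -/
theorem weightedDist_lt_of_nat {n : ℕ} {x : Fin n → ℝ} (hx : ∀ u, 0 < x u) {d d' : ℕ → ℕ → ℕ}
    (hd : ∀ a b, d a b = d b a) (hd' : ∀ a b, d' a b = d' b a) (hd0 : ∀ a, d a a = 0)
    (α β : ℕ → ℤ) (hαβ : ∀ a, α a * β a = 0)
    (h : ∀ a b, a < b → b < n → (d a b : ℤ) + (α a * β b + β a * α b) ≤ d' a b)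
    (hα : 0 < ∑ u : Fin n, x u * α u) (hβ : 0 < ∑ u : Fin n, x u * β u) :
    weightedDist x (fun u v => d u v) < weightedDist x (fun u v => d' u v) := by
  refine weightedDist_lt_of_add_le hx (fun u => (α u : ℝ)) (fun u => (β u : ℝ)) (fun u v => ?_)
    hα hβ
  have key : (d u v : ℤ) + (α u * β v + β u * α v) ≤ d' u v := by
    rcases lt_trichotomy (u : ℕ) v with huv | huv | huv
    · exact h u v huv v.isLt
    · rw [huv, hd0, mul_comm (β v), hαβ]
      simp
    · have := h v u huv u.isLt
      rw [hd, hd']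
      linarith
  exact_mod_cast key

theorem kiteDist_self (a : ℕ) : kiteDist a a = 0 := if_pos rfl

theorem kiteDist_of_lt {a b : ℕ} (h : a < b) :
    kiteDist a b = if b ≤ 1 then 1 else b - max a 1 := by
  unfold kiteDist
  split_ifs <;> omega

/-- The distances in the graph obtained from the kite on `0, …, m - 1` by attaching the pendant
vertex `m` at the vertex `i`. -/
def pendantDist (m i a b : ℕ) : ℕ :=
  if a = b then 0 else if a = m then kiteDist b i + 1 else if b = m then kiteDist a i + 1 else
    kiteDist a b

theorem pendantDist_comm (m i a b : ℕ) : pendantDist m i a b = pendantDist m i b a := by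
  unfold pendantDist
  rw [kiteDist_comm a b]
  split_ifs <;> grind

theorem exists_perm_of_injOn {n : ℕ} (t : ℕ → ℕ) (ht : ∀ a < n, t a < n)
    (hinj : ∀ a b, a < n → b < n → t a = t b → a = b) :
    ∃ τ : Equiv.Perm (Fin n), ∀ a : Fin n, (τ a : ℕ) = t a := by
  have : Function.Bijective fun a : Fin n => (⟨t a, ht a a.isLt⟩ : Fin n) :=
    Finite.injective_iff_bijective.mp fun a b hab =>
      Fin.ext (hinj a b a.isLt b.isLt (congrArg Fin.val hab))
  exact ⟨Equiv.ofBijective _ this, fun a => rfl⟩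

/-- A kite with an additional pendant vertex, not attached at the end of its tail, has smaller
weighted distance than a suitably labelled kite: either the pendant vertex is inserted next to its
neighbour, on the triangle's side, or the part of the tail beyond that neighbour is turned
around. -/
theorem exists_pendantDist_lt {m i : ℕ} (hm : 4 ≤ m) (hi : 1 ≤ i) (him : i + 1 < m)
    {x : Fin (m + 1) → ℝ} (hx : ∀ u, 0 < x u) :
    ∃ τ : Equiv.Perm (Fin (m + 1)), weightedDist x (fun u v => pendantDist m i u v) <
      weightedDist x (fun u v => kiteDist (τ u) (τ v)) := by
  let α : ℕ → ℤ := fun a => if a < i then 1 else 0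
  let β : ℕ → ℤ := fun a => if a = m then -1 else if i < a then 1 else 0
  have hα : 0 < ∑ u : Fin (m + 1), x u * α u := by
    refine Finset.sum_pos' (fun u _ => mul_nonneg (hx u).le ?_) ⟨0, Finset.mem_univ _, ?_⟩
    · simp only [α]; split_ifs <;> simp
    · simp only [α, Fin.val_zero]
      rw [if_pos (by omega)]
      simpa using hx 0
  by_cases hβ : 0 < ∑ u : Fin (m + 1), x u * β u
  -- The tail beyond i outweighs the pendant vertex. Inserting the latter at position i brings it
  -- one step closer to the labels below i and pushes the tail beyond i one step away from them.
  · let t : ℕ → ℕ := fun a => if a = m then i else if a < i then a else a + 1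
    obtain ⟨τ, hτ⟩ := exists_perm_of_injOn (n := m + 1) t
      (fun a ha => by simp only [t]; split_ifs <;> omega)
      (fun a b ha hb => by simp only [t]; split_ifs <;> omega)
    refine ⟨τ, ?_⟩
    simp only [hτ]
    refine weightedDist_lt_of_nat hx (d' := fun a b => kiteDist (t a) (t b)) (pendantDist_comm m i)
      (fun a b => kiteDist_comm _ _) (fun a => by simp [pendantDist]) α β (fun a => ?_)
      (fun a b hab hb => ?_) hα hβ
    · simp only [α, β]; split_ifs <;> omega
    · simp only [α, β, t, pendantDist, kiteDist]
      rw [if_neg (show a ≠ b by omega), if_neg (show a ≠ m by omega)]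
      split_ifs <;> omega
  -- K is the distance that i and the pendant vertex gain from each label below i when the tail is
  -- reversed; vertices beyond i lose at most K. For i = 1 the only such label is the twin 0,
  -- already at distance 1, hence m - 3.
  · obtain ⟨K, hK, hK'⟩ : ∃ K : ℤ, 0 < K ∧ (i ≠ 1 ∧ K + 1 + i = m ∨ i = 1 ∧ K + 3 = m) := by
      by_cases h : i = 1
      · exact ⟨m - 3, by omega⟩
      · exact ⟨m - 1 - i, by omega⟩
    let γ : ℕ → ℤ := fun a => if a = m ∨ a = i then K else if i < a then -K else 0
    have hγ : 0 < ∑ u : Fin (m + 1), x u * γ u := by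
      have h1 : ∑ u : Fin (m + 1), x u * γ u =
          K * (∑ u : Fin (m + 1), (if u = (⟨i, by omega⟩ : Fin (m + 1)) then x u else 0) -
            ∑ u : Fin (m + 1), x u * β u) := by
        rw [← Finset.sum_sub_distrib, Finset.mul_sum]
        refine Finset.sum_congr rfl fun u _ => ?_
        simp only [γ, β, Fin.ext_iff]
        have : m ≠ i := by omega
        split_ifs <;> first | omega | (push_cast; ring)
      rw [h1, Finset.sum_ite_eq' Finset.univ, if_pos (Finset.mem_univ _)]
      have := hx ⟨i, by omega⟩
      exact mul_pos (by exact_mod_cast hK) (by linarith)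
    -- Reversing i, …, m - 1 puts i at position m - 1, so the pendant vertex m now extends the tail.
    let t : ℕ → ℕ := fun a => if a = m ∨ a < i then a else i + m - 1 - a
    obtain ⟨τ, hτ⟩ := exists_perm_of_injOn (n := m + 1) t
      (fun a ha => by simp only [t]; split_ifs <;> omega)
      (fun a b ha hb => by simp only [t]; split_ifs <;> omega)
    refine ⟨τ, ?_⟩
    simp only [hτ]
    refine weightedDist_lt_of_nat hx (d' := fun a b => kiteDist (t a) (t b)) (pendantDist_comm m i)
      (fun a b => kiteDist_comm _ _) (fun a => by simp [pendantDist]) α γ (fun a => ?_)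
      (fun a b hab hb => ?_) hα hγ
    · simp only [α, γ]; split_ifs <;> omega
    · simp only [α, γ, t, pendantDist]
      rw [if_neg (show a ≠ b by omega), if_neg (show a ≠ m by omega)]
      by_cases ha : a < i
      · rw [if_pos ha, if_pos (Or.inr ha), if_neg (show ¬(a = m ∨ a = i) by omega),
          if_neg (show ¬i < a by omega)]
        by_cases hbm : b = m
        · rw [if_pos hbm, if_pos (Or.inl hbm), if_pos (Or.inl hbm)]
          rw [kiteDist_of_lt ha, kiteDist_of_lt hab]
          split_ifs <;> omega
        · rw [if_neg hbm]
          by_cases hbi : b < i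
          · rw [if_pos (Or.inr hbi), if_neg (show ¬(b = m ∨ b = i) by omega),
              if_neg (show ¬i < b by omega)]
            omega
          · rw [if_neg (show ¬(b = m ∨ b < i) by omega)]
            rw [kiteDist_of_lt hab, kiteDist_of_lt (show a < i + m - 1 - b by omega)]
            split_ifs <;> omega
      · rw [if_neg ha, if_neg (show ¬b < i by omega), if_neg (show ¬(a = m ∨ a < i) by omega)]
        by_cases hbm : b = m
        · rw [if_pos hbm, if_pos (Or.inl hbm), if_pos (Or.inl hbm), zero_mul, mul_zero,
            kiteDist_of_lt (show i + m - 1 - a < b by omega)]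
          rcases (Nat.le_of_not_lt ha).eq_or_lt with hai | hai
          · rw [← hai, kiteDist_self]
            split_ifs <;> omega
          · rw [kiteDist_comm, kiteDist_of_lt hai]
            split_ifs <;> omega
        · rw [if_neg hbm, if_neg (show ¬(b = m ∨ b < i) by omega), kiteDist_of_lt hab,
            kiteDist_comm, kiteDist_of_lt (show i + m - 1 - b < i + m - 1 - a by omega)]
          split_ifs <;> omega

/-- An odd cycle of length at least five has smaller weighted distance than the kite obtained by
cutting it at a vertex of maximal weight. -/
theorem weightedDist_cycle_lt {N : ℕ} (hN : Odd N) (h5 : 5 ≤ N) {x : Fin N → ℝ}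
    (hx : ∀ u, 0 < x u) (hmax : ∀ u, x u ≤ x ⟨N - 1, by omega⟩) :
    weightedDist x (fun u v =>
        min (((u : ℕ) - v) + ((v : ℕ) - u)) (N - (((u : ℕ) - v) + ((v : ℕ) - u)))) <
      weightedDist x (fun u v => kiteDist u v) := by
  obtain ⟨k, rfl⟩ := hN
  let α : ℕ → ℤ := fun a => if a = 0 then 1 else 0
  -- Dropping the edge from 0 to 2k and adding the chord from 0 to 2 costs vertex 0 one unit towards
  -- 2, …, k and gains 2k - 2 towards 2k. Since 2k has maximal weight, ⟨x, β⟩ is at least k - 1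
  -- times that weight.
  let β : ℕ → ℤ := fun a => if a = 2 * k then 2 * k - 2 else if 2 ≤ a ∧ a ≤ k then -1 else 0
  refine weightedDist_lt_of_nat hx
    (d := fun a b => min ((a - b) + (b - a)) (2 * k + 1 - ((a - b) + (b - a))))
    (fun a b => by rw [add_comm]) (fun a b => kiteDist_comm a b) (fun a => by simp) α β
    (fun a => ?_) (fun a b hab hb => ?_) ?_ ?_
  · simp only [α, β]; split_ifs <;> omega
  · simp only [α, β, kiteDist]; split_ifs <;> omega
  · simpa [α] using hx _
  · have hle : ∀ u : Fin (2 * k + 1), x ⟨2 * k, by omega⟩ * β u ≤ x u * β u := by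
      intro u
      have := hmax u
      simp only [β]
      split_ifs with h1 h2
      · rw [show u = ⟨2 * k, by omega⟩ from Fin.ext h1]
      · push_cast
        simpa using this
      · simp
    refine lt_of_lt_of_le ?_ (Finset.sum_le_sum fun u _ => hle u)
    rw [← Finset.mul_sum]
    refine mul_pos (hx _) ?_
    have hβ : ∀ a, β a = (if a = 2 * k then 2 * (k : ℤ) - 2 else 0) -
        (if 2 ≤ a ∧ a ≤ k then 1 else 0) := by
      intro a
      simp only [β]
      split_ifs <;> omega
    have hfilter : (Finset.range (2 * k + 1)).filter (fun a => 2 ≤ a ∧ a ≤ k) = Finset.Icc 2 k := by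
      ext a
      simp only [Finset.mem_filter, Finset.mem_range, Finset.mem_Icc]
      omega
    have hsum : ∑ u : Fin (2 * k + 1), β u = 2 * k - 2 - ((k + 1 - 2 : ℕ) : ℤ) := by
      rw [Fin.sum_univ_eq_sum_range β, Finset.sum_congr rfl fun a _ => hβ a,
        Finset.sum_sub_distrib, Finset.sum_boole, hfilter, Nat.card_Icc, Finset.sum_ite_eq',
        if_pos (by simp)]
    have hpos : 0 < ∑ u : Fin (2 * k + 1), β u := by
      rw [hsum]
      omega
    exact_mod_cast hpos

/-! ### Pendant vertices and the transfer of their weight -/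

section PendantExtension

variable {m : ℕ}

/-- The distance function on `Fin (m + 1)` obtained from the distance function `D` on the vertices
other than `l` by making `l` a pendant vertex attached at `p`. -/
def pendantExtension (l : Fin (m + 1)) (p : Fin m) (D : Fin m → Fin m → ℕ) :
    Fin (m + 1) → Fin (m + 1) → ℕ :=
  l.insertNth (α := fun _ => Fin (m + 1) → ℕ)
    (l.insertNth (α := fun _ => ℕ) 0 fun b => D p b + 1)
    fun a => l.insertNth (α := fun _ => ℕ) (D a p + 1) (D a)

variable (l : Fin (m + 1)) (p : Fin m) (D : Fin m → Fin m → ℕ)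

theorem pendantExtension_same : pendantExtension l p D l l = 0 := by
  simp [pendantExtension]

theorem pendantExtension_left (b : Fin m) :
    pendantExtension l p D l (l.succAbove b) = D p b + 1 := by
  simp [pendantExtension]

theorem pendantExtension_right (a : Fin m) :
    pendantExtension l p D (l.succAbove a) l = D a p + 1 := by
  simp [pendantExtension]

theorem pendantExtension_succAbove (a b : Fin m) :
    pendantExtension l p D (l.succAbove a) (l.succAbove b) = D a b := by
  simp [pendantExtension]

/-- Moving the weight of a pendant vertex to its neighbour changes the weighted distance by a
quantity that does not depend on the rest of the graph. -/
theorem weightedDist_pendantExtension (x : Fin (m + 1) → ℝ) (hD : D p p = 0) :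
    weightedDist x (pendantExtension l p D) =
      weightedDist (fun a => x (l.succAbove a) + if a = p then x l else 0) D +
        2 * x l * ∑ a, x (l.succAbove a) := by
  have hR : weightedDist (fun a => x (l.succAbove a) + if a = p then x l else 0) D =
      (∑ a, ∑ b, x (l.succAbove a) * x (l.succAbove b) * D a b) +
        (∑ a, x (l.succAbove a) * x l * D a p) + ∑ b, x l * x (l.succAbove b) * D p b := by
    have h1 : ∀ a, x (l.succAbove a) * x l * D a p =
        ∑ b, x (l.succAbove a) * (if b = p then x l else 0) * D a b := by
      intro a
      simp
    have h2 : ∑ b, x l * x (l.succAbove b) * (D p b : ℝ) =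
        ∑ a, ∑ b, (if a = p then x l else 0) * x (l.succAbove b) * D a b := by
      rw [Finset.sum_comm]
      simp
    have h3 : ∑ a, ∑ b, (if a = p then x l else 0) * (if b = p then x l else 0) * (D a b : ℝ)
        = 0 := by
      simp [hD]
    rw [Finset.sum_congr rfl fun a _ => h1 a, h2]
    refine Eq.trans ?_ ((congrArg (_ + ·) h3).trans (add_zero _))
    simp only [weightedDist, ← Finset.sum_add_distrib]
    exact Finset.sum_congr rfl fun a _ => Finset.sum_congr rfl fun b _ => by ring
  rw [hR, weightedDist, Fin.sum_univ_succAbove _ l]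
  simp only [Fin.sum_univ_succAbove _ l, pendantExtension_same, pendantExtension_left,
    pendantExtension_right, pendantExtension_succAbove, Finset.sum_add_distrib, Nat.cast_add,
    Nat.cast_one, mul_add, mul_one, Nat.cast_zero, mul_zero, zero_add]
  rw [← Finset.mul_sum, ← Finset.sum_mul]
  ring

theorem exists_perm_extend (σ : Equiv.Perm (Fin m)) : ∃ τ : Equiv.Perm (Fin (m + 1)),
    τ l = Fin.last m ∧ ∀ a, τ (l.succAbove a) = (σ a).castSucc := by
  refine ⟨(finSuccEquiv' l).trans (σ.optionCongr.trans (finSuccEquiv' (Fin.last m)).symm), ?_, ?_⟩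
  · simp
  · intro a
    simp

theorem pendantExtension_kiteDist {σ : Equiv.Perm (Fin m)} {τ : Equiv.Perm (Fin (m + 1))}
    (hl : τ l = Fin.last m) (hτ : ∀ a, τ (l.succAbove a) = (σ a).castSucc) (u v : Fin (m + 1)) :
    pendantExtension l p (fun a b => kiteDist (σ a) (σ b)) u v =
      pendantDist m (σ p) (τ u) (τ v) := by
  have hne : ∀ a, (σ a : ℕ) ≠ m := fun a => (σ a).isLt.ne
  induction u using l.succAboveCases with
  | x =>
    induction v using l.succAboveCases with
    | x => simp [pendantExtension_same, pendantDist]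
    | p b =>
      simp [pendantExtension_left, pendantDist, hl, hτ, (hne b).symm, kiteDist_comm]
  | p a =>
    induction v using l.succAboveCases with
    | x => simp [pendantExtension_right, pendantDist, hl, hτ, hne a]
    | p b =>
      simp only [pendantExtension_succAbove, pendantDist, hτ, Fin.val_castSucc, hne, if_false]
      split_ifs with h
      · rw [h, kiteDist_self]
      · rfl

end PendantExtension

/-- Lengthening the tail gives a kite again. For m = 2 this fails, as the attaching vertex would be
1, a twin of 0. -/
theorem pendantDist_end {m a b : ℕ} (hm : 3 ≤ m) (ha : a ≤ m) (hb : b ≤ m) :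
    pendantDist m (m - 1) a b = kiteDist a b := by
  unfold pendantDist kiteDist
  grind

/-! ### The two cases of the induction -/

/-- Walks of G - l survive in G, and l can always be left through p; further neighbours of l only
create shortcuts. -/
theorem dist_le_pendantExtension {m : ℕ} {G : SimpleGraph (Fin (m + 1))} {l : Fin (m + 1)}
    {p : Fin m} (hG : G.Connected) (hG' : (G.comap l.succAbove).Connected)
    (hp : G.Adj l (l.succAbove p)) (u v : Fin (m + 1)) :
    G.dist u v ≤ pendantExtension l p (G.comap l.succAbove).dist u v := by
  have h1 : ∀ a b, G.dist (l.succAbove a) (l.succAbove b) ≤ (G.comap l.succAbove).dist a b := by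
    intro a b
    obtain ⟨w, hw⟩ := hG'.exists_walk_length_eq_dist a b
    let f : G.comap l.succAbove →g G := ⟨l.succAbove, fun h => h⟩
    rw [← hw, ← SimpleGraph.Walk.length_map f w]
    exact SimpleGraph.dist_le _
  have h2 : ∀ b, G.dist l (l.succAbove b) ≤ (G.comap l.succAbove).dist p b + 1 := by
    intro b
    refine (hG.dist_triangle (v := l.succAbove p)).trans ?_
    rw [SimpleGraph.dist_eq_one_iff_adj.mpr hp]
    have := h1 p b
    omega
  induction u using l.succAboveCases with
  | x =>
    induction v using l.succAboveCases with
    | x => simp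
    | p b => rw [pendantExtension_left]; exact h2 b
  | p a =>
    induction v using l.succAboveCases with
    | x =>
      rw [pendantExtension_right, SimpleGraph.dist_comm, SimpleGraph.dist_comm (u := a)]
      exact h2 a
    | p b => rw [pendantExtension_succAbove]; exact h1 a b

/-- Strictness comes from one of three sources: a pendant vertex away from the tail's end, the
inductive inequality, or a second neighbour of l. If all are absent, G is the kite. -/
theorem nonempty_iso_or_exists_lt_of_delete {m : ℕ} (hm : 3 ≤ m) {G : SimpleGraph (Fin (m + 1))}
    {l : Fin (m + 1)} {p : Fin m} (hG : G.Connected) (hG' : (G.comap l.succAbove).Connected)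
    (hp : G.Adj l (l.succAbove p)) {x : Fin (m + 1) → ℝ} (hx : ∀ u, 0 < x u)
    (ih : Nonempty (G.comap l.succAbove ≃g kiteGraph 3 m) ∨ ∃ σ : Equiv.Perm (Fin m),
      weightedDist (fun a => x (l.succAbove a) + if a = p then x l else 0)
        (G.comap l.succAbove).dist <
      weightedDist (fun a => x (l.succAbove a) + if a = p then x l else 0)
        (fun u v => kiteDist (σ u) (σ v))) :
    Nonempty (G ≃g kiteGraph 3 (m + 1)) ∨ ∃ σ : Equiv.Perm (Fin (m + 1)),
      weightedDist x G.dist < weightedDist x (fun u v => kiteDist (σ u) (σ v)) := by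
  set x' : Fin m → ℝ := fun a => x (l.succAbove a) + if a = p then x l else 0 with hx'
  have ih' : ∃ σ : Equiv.Perm (Fin m), ((σ p : ℕ) ≠ 0 ∧ (m = 3 → (σ p : ℕ) = 2)) ∧
      ((∀ a b, (G.comap l.succAbove).dist a b = kiteDist (σ a) (σ b)) ∨
        weightedDist x' (G.comap l.succAbove).dist <
          weightedDist x' (fun u v => kiteDist (σ u) (σ v))) := by
    rcases ih with ⟨⟨e⟩⟩ | ⟨σ, hσ⟩
    -- Kite automorphisms keep p off label 0, where `exists_pendantDist_lt` does not apply, and put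
    -- it at the end when m = 3.
    · obtain ⟨ρ, hρ, h⟩ := exists_perm_kiteDist hm (e p)
      refine ⟨e.toEquiv.trans ρ, h, Or.inl fun a b => ?_⟩
      rw [← e.dist_eq hG', kiteGraph_dist]
      exact (hρ _ _).symm
    · obtain ⟨ρ, hρ, h⟩ := exists_perm_kiteDist hm (σ p)
      refine ⟨σ.trans ρ, h, Or.inr ?_⟩
      simpa only [Equiv.trans_apply, hρ] using hσ
  obtain ⟨σ, ⟨hσ0, hσ3⟩, hσ⟩ := ih'
  obtain ⟨τ, hτl, hτ⟩ := exists_perm_extend l σ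
  have hle1 : weightedDist x G.dist ≤
      weightedDist x (pendantExtension l p (G.comap l.succAbove).dist) :=
    weightedDist_mono (fun u => (hx u).le) (dist_le_pendantExtension hG hG' hp)
  have hsplit1 := weightedDist_pendantExtension l p (G.comap l.succAbove).dist x (by simp)
  have hsplit2 := weightedDist_pendantExtension l p (fun a b => kiteDist (σ a) (σ b)) x
    (kiteDist_self _)
  have hpd : pendantExtension l p (fun a b => kiteDist (σ a) (σ b)) =
      fun u v : Fin (m + 1) => pendantDist m (σ p) (τ u) (τ v) :=
    funext fun u => funext fun v => pendantExtension_kiteDist l p hτl hτ u v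
  rw [hpd] at hsplit2
  have hσp := (σ p).isLt
  rcases Nat.lt_or_ge ((σ p : ℕ) + 1) m with hlt | hge
  · right
    obtain ⟨ρ, hρ⟩ := exists_pendantDist_lt (m := m) (i := σ p) (by omega) (by omega) hlt
      (x := fun u => x (τ.symm u)) (fun u => hx _)
    refine ⟨τ.trans ρ, ?_⟩
    rw [← weightedDist_equiv τ, ← weightedDist_equiv τ (fun u => x (τ.symm u))
      (fun u v => kiteDist (ρ u) (ρ v))] at hρ
    simp only [Equiv.symm_apply_apply] at hρ
    have hle2 : weightedDist x' (G.comap l.succAbove).dist ≤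
        weightedDist x' (fun u v => kiteDist (σ u) (σ v)) := by
      rcases hσ with h | h
      · exact le_of_eq (congrArg _ (funext fun a => funext fun b => h a b))
      · exact h.le
    simp only [Equiv.trans_apply]
    linarith
  · have hσm : (σ p : ℕ) = m - 1 := by omega
    have hkite : (fun u v : Fin (m + 1) => pendantDist m (σ p) (τ u) (τ v)) =
        fun u v => kiteDist (τ u) (τ v) := by
      funext u v
      rw [hσm]
      exact pendantDist_end hm (Fin.is_le _) (Fin.is_le _)
    rw [hkite] at hsplit2
    rcases hσ with h | h
    · have hD : (G.comap l.succAbove).dist = fun a b => kiteDist (σ a) (σ b) :=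
        funext fun a => funext fun b => h a b
      by_cases hq : ∃ q, q ≠ p ∧ G.Adj l (l.succAbove q)
      · right
        obtain ⟨q, hqp, hq⟩ := hq
        refine ⟨τ, ?_⟩
        have hlt : weightedDist x G.dist <
            weightedDist x (pendantExtension l p (G.comap l.succAbove).dist) := by
          refine weightedDist_lt hx (dist_le_pendantExtension hG hG' hp) (a := l)
            (b := l.succAbove q) ?_
          rw [pendantExtension_left, SimpleGraph.dist_eq_one_iff_adj.mpr hq]
          have := hG'.pos_dist_of_ne hqp.symm
          omega
        rw [hD] at hsplit1
        rw [hD] at hlt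
        linarith
      · left
        push Not at hq
        have hl : ∀ b, G.Adj l (l.succAbove b) ↔ kiteDist m (σ b) = 1 := by
          intro b
          have hb : kiteDist m (σ b) = 1 ↔ (σ b : ℕ) = m - 1 := by
            have := (σ b).isLt
            rw [kiteDist_comm, kiteDist_of_lt this]
            split_ifs <;> omega
          rw [hb, ← hσm, ← Fin.ext_iff, σ.injective.eq_iff]
          exact ⟨fun h => by_contra fun hne => hq b hne h, fun h => h ▸ hp⟩
        refine ⟨⟨τ, @fun u v => ?_⟩⟩
        rw [kiteGraph_adj_iff_kiteDist]
        induction u using l.succAboveCases with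
        | x =>
          induction v using l.succAboveCases with
          | x => simp [kiteDist_self]
          | p b => rw [hl, hτl, hτ]; rfl
        | p a =>
          induction v using l.succAboveCases with
          | x => rw [G.adj_comm, hl, hτl, hτ, kiteDist_comm]; rfl
          | p b =>
            rw [hτ, hτ, ← SimpleGraph.comap_adj (f := l.succAbove),
              ← SimpleGraph.dist_eq_one_iff_adj, h]
            rfl
    · right
      exact ⟨τ, by linarith⟩

theorem nonempty_iso_or_exists_lt_of_hamiltonian {N : ℕ} (hN : Odd N) (h3 : 3 ≤ N)
    {G : SimpleGraph (Fin N)} (hG : G.Connected) {c : ℕ → Fin N}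
    (hadj : ∀ i, G.Adj (c i) (c (i + 1))) (hper : ∀ i, c (i + N) = c i)
    (hinj : ∀ i j, i < N → j < N → c i = c j → i = j) {x : Fin N → ℝ} (hx : ∀ u, 0 < x u) :
    Nonempty (G ≃g kiteGraph 3 N) ∨ ∃ σ : Equiv.Perm (Fin N),
      weightedDist x G.dist < weightedDist x (fun u v => kiteDist (σ u) (σ v)) := by
  have : Nonempty (Fin N) := ⟨c 0⟩
  obtain ⟨w, hw⟩ := Finite.exists_max x
  obtain ⟨r, hr⟩ : ∃ r : Fin N, c r = w :=
    Finite.injective_iff_surjective.mp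
      (fun i j hij => Fin.ext (hinj i j i.isLt j.isLt hij) :
        Function.Injective fun i : Fin N => c i) w
  have hper' : Function.Periodic c N := hper
  -- The cycle is rotated so that the heaviest vertex `c r` receives the label N - 1.
  have hbij : Function.Bijective fun j : Fin N => c (r + 1 + j) := by
    refine Finite.injective_iff_bijective.mp fun i j hij => Fin.ext ?_
    have hmod : r + 1 + i ≡ r + 1 + j [MOD N] := by
      refine hinj _ _ (Nat.mod_lt _ (by omega)) (Nat.mod_lt _ (by omega)) ?_
      rw [hper'.map_mod_nat, hper'.map_mod_nat]
      exact hij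
    exact (Nat.ModEq.add_left_cancel' _ hmod).eq_of_lt_of_lt i.isLt j.isLt
  let e : Equiv.Perm (Fin N) := Equiv.ofBijective _ hbij
  have he : ∀ j : Fin N, e j = c (r + 1 + j) := fun j => rfl
  have hdist : ∀ i j : Fin N, G.dist (e i) (e j) ≤
      min (((i : ℕ) - j) + ((j : ℕ) - i)) (N - (((i : ℕ) - j) + ((j : ℕ) - i))) := by
    intro i j
    wlog hij : i ≤ j generalizing i j
    · rw [SimpleGraph.dist_comm, add_comm]
      exact this j i (le_of_not_ge hij)
    have hij' : (i : ℕ) ≤ j := hij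
    have h1 := SimpleGraph.dist_le_of_adj_succ hG hadj (r + 1 + i) (j - i)
    have h2 := SimpleGraph.dist_le_of_adj_succ hG hadj (r + 1 + j) (N - (j - i))
    rw [show (r : ℕ) + 1 + i + (j - i) = r + 1 + j by omega] at h1
    rw [show (r : ℕ) + 1 + j + (N - (j - i)) = r + 1 + i + N by omega, hper,
      SimpleGraph.dist_comm] at h2
    rw [he, he, Nat.sub_eq_zero_of_le hij', zero_add]
    exact le_min h1 h2
  rcases Nat.lt_or_ge N 5 with h5 | h5
  · left
    have hN3 : N = 3 := by
      rw [Nat.odd_iff] at hN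
      omega
    subst hN3
    refine ⟨⟨Equiv.refl _, @fun u v => ?_⟩⟩
    rw [kiteGraph_adj_iff_kiteDist, kiteDist_eq_ite_of_lt_three (Fin.isLt _) (Fin.isLt _)]
    constructor
    · intro h
      have hne : u ≠ v := by
        rintro rfl
        simp at h
      have h1 := hdist (e.symm u) (e.symm v)
      rw [e.apply_symm_apply, e.apply_symm_apply] at h1
      rw [← SimpleGraph.dist_eq_one_iff_adj]
      have := hG.pos_dist_of_ne hne
      omega
    · intro h
      have := h.ne
      simpa [← Fin.ext_iff] using this
  · right
    refine ⟨e.symm, ?_⟩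
    have hlt := weightedDist_cycle_lt hN h5 (x := fun u => x (e u)) (fun u => hx _) (fun u => by
      have : e ⟨N - 1, by omega⟩ = w := by
        rw [he, ← hr, ← hper r]
        congr 1
        simp only
        omega
      rw [this]
      exact hw _)
    rw [← weightedDist_equiv e, ← weightedDist_equiv e x (fun u v => kiteDist (e.symm u) _)]
    simp only [Equiv.symm_apply_apply]
    exact (weightedDist_mono (fun u => (hx _).le) hdist).trans_lt hlt

/-! ### The induction and the conclusion -/

/-- For every positive weight, a connected non-bipartite graph that is not a kite has smaller
weighted distance than some kite on the same vertices. -/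
theorem nonempty_iso_or_exists_weightedDist_lt {n : ℕ} {G : SimpleGraph (Fin n)}
    (hG : G.Connected) (hc : ¬G.Colorable 2) {x : Fin n → ℝ} (hx : ∀ u, 0 < x u) :
    Nonempty (G ≃g kiteGraph 3 n) ∨ ∃ σ : Equiv.Perm (Fin n),
      weightedDist x G.dist < weightedDist x (fun u v => kiteDist (σ u) (σ v)) := by
  have three_le : ∀ {k : ℕ} {H : SimpleGraph (Fin k)}, ¬H.Colorable 2 → 3 ≤ k := by
    intro k H hH
    by_contra hk
    exact hH (H.colorable_of_fintype.mono (by rw [Fintype.card_fin]; omega))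
  -- The weight is generalised with n: the inductive hypothesis is applied to the shifted weight,
  -- which need not be a Perron vector of G - l.
  induction n with
  | zero => exact absurd (three_le hc) (by omega)
  | succ m ih =>
    rcases SimpleGraph.exists_delete_or_odd_hamiltonian hG hc with
      ⟨l, hG', hc'⟩ | ⟨c, hN, hadj, hper, hinj⟩
    · have hm := three_le hc'
      obtain ⟨q, hq⟩ : ∃ q, G.Adj l q := by
        obtain ⟨w⟩ := hG.preconnected l (l.succAbove ⟨0, by omega⟩)
        exact ⟨_, w.adj_snd (SimpleGraph.Walk.not_nil_of_ne (Fin.succAbove_ne _ _).symm)⟩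
      obtain ⟨p, rfl⟩ := Fin.exists_succAbove_eq hq.ne'
      refine nonempty_iso_or_exists_lt_of_delete hm hG hG' hq hx (ih hG' hc' fun a => ?_)
      have := hx (l.succAbove a)
      split_ifs
      · linarith [hx l]
      · linarith
    · exact nonempty_iso_or_exists_lt_of_hamiltonian hN (three_le hc) hG hadj hper hinj hx

theorem nonempty_iso_or_distSpectralRadius_lt {n : ℕ} {G : SimpleGraph (Fin n)} (hn : 3 ≤ n)
    (hG : G.Connected) (hc : ¬G.Colorable 2) :
    Nonempty (G ≃g kiteGraph 3 n) ∨ distSpectralRadius G < distSpectralRadius (kiteGraph 3 n) := by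
  have : Nontrivial (Fin n) := Fin.nontrivial_iff_two_le.mpr (by omega)
  obtain ⟨x, hx, hxq⟩ := exists_pos_eigenvector hG
  refine (nonempty_iso_or_exists_weightedDist_lt hG hc hx).imp_right fun ⟨σ, hσ⟩ => ?_
  have h := weightedDist_le_distSpectralRadius (kiteGraph 3 n) (fun u => x (σ.symm u))
  rw [← weightedDist_equiv σ, σ.symm.sum_comp fun u => x u * x u] at h
  simp only [Equiv.symm_apply_apply, kiteGraph_dist] at h
  rw [hxq] at hσ
  exact lt_of_mul_lt_mul_right (hσ.trans_le h)
    (Finset.sum_nonneg fun u _ => (mul_pos (hx u) (hx u)).le)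

theorem mainTheorem3 (n : ℕ) (hn : 3 ≤ n) :
    IsConnectedChromatic 3 n (kiteGraph 3 n) ∧
    ∀ (V : Type*) [Fintype V] (G : SimpleGraph V), IsConnectedChromatic 3 n G →
      distSpectralRadius G ≤ distSpectralRadius (kiteGraph 3 n) ∧
      (distSpectralRadius G = distSpectralRadius (kiteGraph 3 n) ↔
        Nonempty (G ≃g kiteGraph 3 n)) := by
  refine ⟨⟨kiteGraph_connected (by omega), kiteGraph_chromaticNumber hn, Fintype.card_fin n⟩, ?_⟩
  rintro V _ G ⟨hG, hχ, hcard⟩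
  have : Nontrivial V := Fintype.one_lt_card_iff_nontrivial.mp (by omega)
  let e : V ≃ Fin n := Fintype.equivFinOfCardEq hcard
  -- The induction deletes vertices by `Fin.succAbove`, so G is first moved to `Fin n`.
  let H : SimpleGraph (Fin n) := G.map e.toEmbedding
  let f : G ≃g H := SimpleGraph.Iso.map e G
  have hH : H.Connected := f.connected_iff.mp hG
  have hc : ¬H.Colorable 2 := fun h =>
    (SimpleGraph.chromaticNumber_eq_iff_colorable_not_colorable (n := 2).mp hχ).2
      (h.of_hom f.toHom)
  have hiso : Nonempty (G ≃g kiteGraph 3 n) →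
      distSpectralRadius G = distSpectralRadius (kiteGraph 3 n) := fun ⟨g⟩ =>
    g.distSpectralRadius_eq hG
  rcases nonempty_iso_or_distSpectralRadius_lt hn hH hc with ⟨⟨g⟩⟩ | hlt
  · have hg : Nonempty (G ≃g kiteGraph 3 n) := ⟨f.trans g⟩
    exact ⟨(hiso hg).le, fun _ => hg, hiso⟩
  · rw [← f.distSpectralRadius_eq hG] at hlt
    exact ⟨hlt.le, fun h => absurd h hlt.ne, hiso⟩
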